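/- Lemma 4.9 (controlling excess of $S(t_0)$). Let $S:\mathbb{R}\rightrightarrows\mathbb{R}^n$ be a multivalued map with domain $\mathrm{dom}(S)=\{t: S(t)\neq\emptyset\}$ and graph $\mathcal{S}=\{(t,x)\in\mathbb{R}^{n+1}: x\in S(t)\}$. Suppose that $S$ is a *smooth sweeping process*: $\mathcal{S}$ is a nonempty, closed and connected subset of $\mathbb{R}^{n+1}$, and either $\mathcal{S}$ is an embedded $\mathcal{C}^1$ submanifold (without boundary) of $\mathbb{R}^{n+1}$ of dimension at most $n$, or $\mathcal{S}$ is a full-dimensional $\mathcal{C}^1$ submanifold with (possibly empty) boundary of $\mathbb{R}^{n+1}$ whose boundary $\partial\mathcal{S}$ is a $\mathcal{C}^1$ manifold of dimension $n$. For $C\subseteq\mathbb{R}^{n+1}$ and $z\in C$ let $\hat N_C(z)$ be the Fréchet normal cone, that is, the set of all $v$ with $\limsup_{y\to z,\ y\in C\setminus\{z\}}\langle v,y-z\rangle/\|y-z\|\le 0$ (all of $\mathbb{R}^{n+1}$ if $z$ is isolated in $C$), and let $N_C(z)$ be the limiting normal cone, that is, the set of all limits $v=\lim v_i$ with $v_i\in\hat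 N_C(z_i)$, $z_i\in C$, $z_i\to z$. For $(t,x)\in\mathcal{S}$ and $u\in\mathbb{R}^n$ put $D^*S(t,x)(u)=\{a\in\mathbb{R}:(a,-u)\in N_{\mathcal{S}}(t,x)\}$, and, with $a^+=\max\{0,a\}$, $$\|D^*S(t,x)\|^+=\sup\{|a|: a\in D^*S(t,x)(u),\ \|u\|\le 1\},\qquad \|D^*S(t,x)|^+=\sup\{a^+: a\in D^*S(t,x)(u),\ \|u\|\le 1\},$$ $$\varphi(t)=\sup_{x\in S(t)}\|D^*S(t,x)\|^+,\qquad \varphi^{\uparrow}(t)=\sup_{x\in S(t)}\|D^*S(t,x)|^+ ,$$ all with values in $[0,+\infty]$. For nonempty $A,B\subseteq\mathbb{R}^n$ let $\mathrm{ex}(A,B)=\sup_{x\in A}d(x,B)$ and $\mathrm{dist}(A,B)=\max\{\mathrm{ex}(A,B),\mathrm{ex}(B,A)\}$, with values in $[0,+\infty]$. Let $t_0\le t_1$ be real numbers with $[t_0,t_1]\subset\mathrm{dom}(S)$. Then $$\mathrm{ex}(S(t_0),S(t_1))\le\Big(\sup_{t\in[t_0,t_1]}\varphi^{\uparrow}(t)\Big)(t_1-t_0)\qquad\text{and}\qquad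 \mathrm{dist}(S(t_0),S(t_1))\le\Big(\sup_{t\in[t_0,t_1]}\varphi(t)\Big)(t_1-t_0),$$ where $(+\infty)\cdot 0=0$. -/

import Mathlib

open Filter Topology Set
open scoped ENNReal

namespace Sweeping

/-- The Euclidean space `ℝⁿ`. -/
abbrev Space (n : ℕ) : Type := EuclideanSpace ℝ (Fin n)

/-- The Euclidean space `ℝⁿ⁺¹ = ℝ × ℝⁿ` of pairs (time, position), with the Euclidean
inner product `⟪(a, u), (b, v)⟫ = a b + ⟪u, v⟫`. -/
abbrev TimeSpace (n : ℕ) : Type := WithLp 2 (ℝ × Space n)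

section Normals

variable {E : Type*} [NormedAddCommGroup E] [InnerProductSpace ℝ E]

/-- The Fréchet normal cone to `C` at `x`: the vectors `v` with
`limsup ⟪v, y - x⟫ / ‖y - x‖ ≤ 0` as `y → x`, `y ∈ C`, `y ≠ x`
(empty when `x ∉ C`). The upper limit is taken in the extended reals. -/
def frechetNormalCone (C : Set E) (x : E) : Set E :=
  {v | x ∈ C ∧
    limsup (fun y : E => ((inner ℝ v (y - x) / ‖y - x‖ : ℝ) : EReal)) (𝓝[C \ {x}] x) ≤ 0}

/-- The limiting normal cone to `C` at `x`. -/
def limitingNormalCone (C : Set E) (x : E) : Set E :=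
  {v | ∃ (y : ℕ → E) (w : ℕ → E), (∀ i, y i ∈ C) ∧ (∀ i, w i ∈ frechetNormalCone C (y i)) ∧
    Tendsto y atTop (𝓝 x) ∧ Tendsto w atTop (𝓝 v)}

/-- `Φ` is a `C¹` diffeomorphism between two open subsets of `E`. -/
def IsC1LocalDiffeo (Φ : OpenPartialHomeomorph E E) : Prop :=
  ContDiffOn ℝ 1 Φ Φ.source ∧ ContDiffOn ℝ 1 Φ.symm Φ.target

/-- `M` is an (embedded) `C¹` submanifold of `E`, without boundary, of dimension `k`: near each
of its points it is carried by a `C¹` diffeomorphism between open subsets of `E` to a linear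
subspace of dimension `k`. -/
def IsC1Submanifold (M : Set E) (k : ℕ) : Prop :=
  ∀ p ∈ M, ∃ (Φ : OpenPartialHomeomorph E E) (L : Submodule ℝ E),
    p ∈ Φ.source ∧ IsC1LocalDiffeo Φ ∧ Module.finrank ℝ L = k ∧
      ∀ y ∈ Φ.source, (y ∈ M ↔ Φ y ∈ L)

/-- `M` is a full-dimensional `C¹` submanifold with (possibly empty) boundary of `E`: near each
of its points it is carried by a `C¹` diffeomorphism between open subsets of `E` to a closed half
space. (At interior points of `M` the image of the point lies in the open half space.) -/
def IsC1FullManifoldWithBoundary (M : Set E) : Prop :=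
  ∀ p ∈ M, ∃ (Φ : OpenPartialHomeomorph E E) (e : E),
    p ∈ Φ.source ∧ IsC1LocalDiffeo Φ ∧ e ≠ 0 ∧
      ∀ y ∈ Φ.source, (y ∈ M ↔ 0 ≤ inner ℝ e (Φ y))

end Normals

section Maps

variable {n : ℕ}

/-- The effective domain of the multivalued map `S`. -/
def dom (S : ℝ → Set (Space n)) : Set ℝ := {t | (S t).Nonempty}

/-- The graph of the multivalued map `S`, as a subset of `ℝⁿ⁺¹`. -/
def graph (S : ℝ → Set (Space n)) : Set (TimeSpace n) := {p | p.snd ∈ S p.fst}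

/-- The (limiting) coderivative `D*S(t, x)(u) = {a : (a, -u) ∈ N_{gph S}(t, x)}`. -/
def coderivative (S : ℝ → Set (Space n)) (t : ℝ) (x : Space n) (u : Space n) : Set ℝ :=
  {a | (WithLp.toLp 2 (a, -u) : TimeSpace n) ∈
    limitingNormalCone (graph S) (WithLp.toLp 2 (t, x))}

/-- The modulus `‖D*S(t, x)‖⁺ = sup {|a| : a ∈ D*S(t, x)(u), ‖u‖ ≤ 1}`, in `[0, ∞]`. -/
noncomputable def modulus (S : ℝ → Set (Space n)) (t : ℝ) (x : Space n) : ℝ≥0∞ :=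
  ⨆ (u : Space n) (_ : ‖u‖ ≤ 1) (a : ℝ) (_ : a ∈ coderivative S t x u), ENNReal.ofReal |a|

/-- The asymmetric modulus `‖D*S(t, x)|⁺ = sup {a⁺ : a ∈ D*S(t, x)(u), ‖u‖ ≤ 1}`, with
`a⁺ = max {0, a}`, in `[0, ∞]`. -/
noncomputable def asymModulus (S : ℝ → Set (Space n)) (t : ℝ) (x : Space n) : ℝ≥0∞ :=
  ⨆ (u : Space n) (_ : ‖u‖ ≤ 1) (a : ℝ) (_ : a ∈ coderivative S t x u),
    ENNReal.ofReal (max 0 a)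

/-- The talweg function `φ(t) = sup {‖D*S(t, x)‖⁺ : x ∈ S(t)}`, in `[0, ∞]`. -/
noncomputable def talweg (S : ℝ → Set (Space n)) (t : ℝ) : ℝ≥0∞ :=
  ⨆ x ∈ S t, modulus S t x

/-- The oriented talweg function `φ↑(t) = sup {‖D*S(t, x)|⁺ : x ∈ S(t)}`, in `[0, ∞]`. -/
noncomputable def orientedTalweg (S : ℝ → Set (Space n)) (t : ℝ) : ℝ≥0∞ :=
  ⨆ x ∈ S t, asymModulus S t x

/-- Smooth sweeping process: the graph is closed and connected, and it is either a `C¹`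
submanifold of `ℝⁿ⁺¹` of dimension at most `n`, or a full-dimensional manifold with boundary
whose boundary is a `C¹` manifold of dimension `n`. -/
structure IsSmoothSweepingProcess (S : ℝ → Set (Space n)) : Prop where
  isClosed_graph : IsClosed (graph S)
  isConnected_graph : IsConnected (graph S)
  smooth : (∃ k ≤ n, IsC1Submanifold (graph S) k) ∨
    (IsC1FullManifoldWithBoundary (graph S) ∧ IsC1Submanifold (frontier (graph S)) n)

/-- The excess `ex(A, B) = sup {d(x, B) : x ∈ A}`, in `[0, ∞]`. -/
noncomputable def excess (A B : Set (Space n)) : ℝ≥0∞ := ⨆ x ∈ A, Metric.infEDist x B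

end Maps

end Sweeping

/-!
The excess bound is a consequence of Fermat's rule on the closed graph `C` of `S`. Fix `x₀ ∈ S t`,
a target time `t' = t + σ T` with `σ = ± 1`, a bound `K` on the coderivative at the times between
`t` and `t'`, and `δ > 0`. Over the points `(s, y)` of `C` with `s` not beyond `t'`, minimise the
smooth function `f (s, y) = √(‖y - x₀‖² + δ²) - (K + δ) σ (s - t)`. Its value at `(t, x₀)` is `δ`,
and it exceeds `δ` at all times on the side of `t` away from `t'`, so the minimum is attained, at
a time between `t` and `t'`. If that time were not `t'`, the minimiser would be a local minimiser
of `f` on all of `C`, so minus the gradient of `f` would be a Fréchet normal `(σ (K + δ), -u)` with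
`‖u‖ ≤ 1` (`neg_gradient_mem_frechetNormalCone`), against the bound `K`. Hence the minimiser lies
in `S t'`, and comparing its value with `δ` gives `d (x₀, S t') ≤ δ + (K + δ) T`; now let `δ → 0`
(`infEDist_le_of_normals`). The bound on the Hausdorff distance uses both directions of time.
-/

namespace Sweeping

section Normals

variable {E : Type*} [NormedAddCommGroup E] [InnerProductSpace ℝ E]

/-- Fermat's rule. -/
theorem neg_gradient_mem_frechetNormalCone {C : Set E} {f : E → ℝ} {q v : E} (hq : q ∈ C)
    (hf : HasFDerivAt f (-(innerSL ℝ v)) q) (hmin : IsLocalMinOn f C q) :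
    v ∈ frechetNormalCone C q := by
  refine ⟨hq, EReal.le_of_forall_lt_iff_le.1 fun ε hε => ?_⟩
  have hε' : 0 < ε := by exact_mod_cast hε
  refine limsup_le_of_le (by isBoundedDefault) ?_
  have h1 := nhdsWithin_le_nhds (s := C \ {q}) ((hasFDerivAt_iff_isLittleO.1 hf).def hε')
  have h2 := nhdsWithin_mono q (sdiff_subset : C \ {q} ⊆ C) hmin
  filter_upwards [h1, h2, self_mem_nhdsWithin] with y hy1 hy2 hy3
  have hpos : 0 < ‖y - q‖ := norm_pos_iff.2 (sub_ne_zero.2 hy3.2)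
  have h3 := (le_abs_self _).trans hy1
  simp only [neg_apply, innerSL_apply_apply] at h3
  have hy2' : f q ≤ f y := hy2
  refine EReal.coe_le_coe_iff.2 ((div_le_iff₀ hpos).2 ?_)
  linarith

theorem frechetNormalCone_subset_limitingNormalCone (C : Set E) (x : E) :
    frechetNormalCone C x ⊆ limitingNormalCone C x := fun v hv =>
  ⟨fun _ => x, fun _ => v, fun _ => hv.1, fun _ => hv, tendsto_const_nhds, tendsto_const_nhds⟩

end Normals

variable {n : ℕ}

/-- A smooth approximation, from above, of `‖y - x₀‖` minus a multiple `c` of the elapsed time.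
Minus its gradient is written as `(c, -u)` with `‖u‖ ≤ 1`, the form in which normals enter the
coderivative. -/
theorem hasFDerivAt_sqrt_sub (x₀ : Space n) (t c δ : ℝ) (hδ : 0 < δ) (q : TimeSpace n) :
    ∃ u : Space n, ‖u‖ ≤ 1 ∧
      HasFDerivAt (fun p : TimeSpace n => √(‖p.snd - x₀‖ ^ 2 + δ ^ 2) - c * (p.fst - t))
        (-(innerSL ℝ (WithLp.toLp 2 (c, -u) : TimeSpace n))) q := by
  have hpos : 0 < ‖q.snd - x₀‖ ^ 2 + δ ^ 2 := by positivity
  set r := √(‖q.snd - x₀‖ ^ 2 + δ ^ 2) with hr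
  have hr0 : 0 < r := Real.sqrt_pos.2 hpos
  refine ⟨r⁻¹ • (q.snd - x₀), ?_, ?_⟩
  · rw [norm_smul, norm_inv, Real.norm_of_nonneg hr0.le, inv_mul_le_iff₀ hr0, mul_one]
    exact Real.le_sqrt_of_sq_le (by nlinarith)
  · have hs : HasFDerivAt (fun p : TimeSpace n => p.snd - x₀)
        (WithLp.sndL 2 ℝ ℝ (Space n)) q :=
      (WithLp.sndL 2 ℝ ℝ (Space n)).hasFDerivAt.sub_const x₀
    have ht : HasFDerivAt (fun p : TimeSpace n => p.fst - t)
        (WithLp.fstL 2 ℝ ℝ (Space n)) q :=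
      (WithLp.fstL 2 ℝ ℝ (Space n)).hasFDerivAt.sub_const t
    have h := ((hs.norm_sq.add_const (δ ^ 2)).sqrt hpos.ne').sub (ht.const_mul c)
    refine h.congr_fderiv ?_
    ext p
    simp only [← hr]
    simp [WithLp.prod_inner_apply, inner_smul_left]
    field_simp
    simp only [inner_sub_left]
    ring

/-- If all Fréchet normals to the graph, at times between `t` and `t + σ T` with `σ = ± 1`, satisfy
the one-sided bound `K`, then points of `S t` are at distance at most `K T` from `S (t + σ T)`. -/
theorem infEDist_le_of_normals {S : ℝ → Set (Space n)} (hS : IsClosed (graph S)) {t σ T K : ℝ}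
    (hσ : σ * σ = 1) (hT : 0 ≤ T) (hK : 0 ≤ K)
    (hN : ∀ p ∈ graph S, 0 ≤ σ * (p.fst - t) → σ * (p.fst - t) ≤ T → ∀ (u : Space n) (a : ℝ),
      ‖u‖ ≤ 1 → (WithLp.toLp 2 (a, -u) : TimeSpace n) ∈ frechetNormalCone (graph S) p →
        σ * a ≤ K)
    {x₀ : Space n} (hx₀ : x₀ ∈ S t) :
    Metric.infEDist x₀ (S (t + σ * T)) ≤ ENNReal.ofReal (K * T) := by
  have key : ∀ δ > 0, Metric.infEDist x₀ (S (t + σ * T)) ≤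
      ENNReal.ofReal (δ + (K + δ) * T) := by
    intro δ hδ
    let f : TimeSpace n → ℝ :=
      fun p => √(‖p.snd - x₀‖ ^ 2 + δ ^ 2) - (K + δ) * σ * (p.fst - t)
    have hKδ : 0 < K + δ := by linarith
    have hsnd : Continuous fun p : TimeSpace n => p.snd :=
      (WithLp.sndL 2 ℝ ℝ (Space n)).continuous
    have hfst : Continuous fun p : TimeSpace n => p.fst :=
      (WithLp.fstL 2 ℝ ℝ (Space n)).continuous
    have hfc : Continuous f := by fun_prop
    have hge : ∀ p : TimeSpace n, δ ≤ √(‖p.snd - x₀‖ ^ 2 + δ ^ 2) := fun p =>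
      Real.le_sqrt_of_sq_le (by nlinarith [sq_nonneg ‖p.snd - x₀‖])
    have hnorm : ∀ p : TimeSpace n, ‖p.snd - x₀‖ ≤ √(‖p.snd - x₀‖ ^ 2 + δ ^ 2) := fun p =>
      Real.le_sqrt_of_sq_le (by nlinarith [sq_nonneg δ])
    -- Points where `f ≤ δ` never lie on the wrong side of time `t`; hence the minimiser below is free
    -- of any constraint there, even when it is `(t, x₀)` itself.
    have hlate : ∀ p, f p ≤ δ → 0 ≤ σ * (p.fst - t) := by
      intro p hp
      have h1 : √(‖p.snd - x₀‖ ^ 2 + δ ^ 2) - (K + δ) * σ * (p.fst - t) ≤ δ := hp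
      have h2 := hge p
      refine nonneg_of_mul_nonneg_right (a := K + δ) ?_ hKδ
      linarith
    have hnear : ∀ p, f p ≤ δ → σ * (p.fst - t) ≤ T → ‖p.snd - x₀‖ ≤ δ + (K + δ) * T := by
      intro p hp hpT
      have h1 : √(‖p.snd - x₀‖ ^ 2 + δ ^ 2) - (K + δ) * σ * (p.fst - t) ≤ δ := hp
      have h2 := hnorm p
      have h3 := mul_le_mul_of_nonneg_left hpT hKδ.le
      linarith
    let D : Set (TimeSpace n) := {p | p ∈ graph S ∧ σ * (p.fst - t) ≤ T ∧ f p ≤ δ}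
    have hDclosed : IsClosed D := by
      have h1 : IsClosed {p : TimeSpace n | σ * (p.fst - t) ≤ T} :=
        isClosed_le (by fun_prop) continuous_const
      exact hS.inter (h1.inter (isClosed_le hfc continuous_const))
    let z : TimeSpace n := WithLp.toLp 2 (t, x₀)
    have hDbdd : Bornology.IsBounded D := by
      refine (Metric.isBounded_closedBall (x := z) (r := T + (δ + (K + δ) * T))).subset ?_
      rintro p ⟨-, hpT, hpf⟩
      have h1 := hlate p hpf
      have h2 := hnear p hpf hpT
      have h3 : (p.fst - t) ^ 2 ≤ T ^ 2 := by nlinarith [mul_self_le_mul_self h1 hpT]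
      rw [Metric.mem_closedBall, dist_eq_norm, WithLp.prod_norm_eq_of_L2]
      refine Real.sqrt_le_iff.2 ⟨by positivity, ?_⟩
      have h4 : 0 ≤ (K + δ) * T := by positivity
      have h5 : ‖p.snd - x₀‖ ^ 2 ≤ (δ + (K + δ) * T) ^ 2 := by gcongr
      change ‖p.fst - t‖ ^ 2 + ‖p.snd - x₀‖ ^ 2 ≤ _
      rw [Real.norm_eq_abs, sq_abs]
      nlinarith [mul_nonneg hT (add_nonneg hδ.le h4)]
    have hzD : z ∈ D := by
      refine ⟨hx₀, by simpa [z] using hT, ?_⟩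
      simp [f, z, Real.sqrt_sq hδ.le]
    have : ProperSpace (TimeSpace n) := FiniteDimensional.proper_real _
    obtain ⟨q, ⟨hqS, hqT, hqδ⟩, hqmin⟩ :=
      (Metric.isCompact_of_isClosed_isBounded hDclosed hDbdd).exists_isMinOn ⟨z, hzD⟩
        hfc.continuousOn
    rcases hqT.lt_or_eq with hlt | heq
    · exfalso
      have hloc : IsLocalMinOn f (graph S) q := by
        have hev : ∀ᶠ p in 𝓝[graph S] q, σ * (p.fst - t) < T :=
          nhdsWithin_le_nhds ((isOpen_lt (by fun_prop) continuous_const).mem_nhds hlt)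
        filter_upwards [hev, self_mem_nhdsWithin] with p hpT hpS
        rcases le_total (f p) δ with hp | hp
        · exact hqmin ⟨hpS, hpT.le, hp⟩
        · exact hqδ.trans hp
      obtain ⟨u, hu, hder⟩ := hasFDerivAt_sqrt_sub x₀ t ((K + δ) * σ) δ hδ q
      have h := hN q hqS (hlate q hqδ) hqT u _ hu
        (neg_gradient_mem_frechetNormalCone hqS hder hloc)
      have : σ * ((K + δ) * σ) = K + δ := by linear_combination (K + δ) * hσ
      linarith
    · have hqt : q.fst = t + σ * T := by
        rw [← heq]
        linear_combination (-(q.fst - t)) * hσ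
      have hmem : q.snd ∈ S (t + σ * T) := hqt ▸ hqS
      refine (Metric.infEDist_le_edist_of_mem hmem).trans ?_
      rw [edist_dist, dist_comm, dist_eq_norm]
      exact ENNReal.ofReal_le_ofReal (hnear q hqδ hqT)
  have hlim : Tendsto (fun δ : ℝ => ENNReal.ofReal (δ + (K + δ) * T)) (𝓝[>] 0)
      (𝓝 (ENNReal.ofReal (K * T))) := by
    have hc : Continuous fun δ : ℝ => ENNReal.ofReal (δ + (K + δ) * T) :=
      ENNReal.continuous_ofReal.comp (by fun_prop)
    simpa using (hc.tendsto 0).mono_left nhdsWithin_le_nhds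
  exact ge_of_tendsto hlim (by filter_upwards [self_mem_nhdsWithin] with δ hδ using key δ hδ)

theorem max_zero_le_orientedTalweg {S : ℝ → Set (Space n)} {p : TimeSpace n} (hp : p ∈ graph S)
    {u : Space n} (hu : ‖u‖ ≤ 1) {a : ℝ}
    (ha : (WithLp.toLp 2 (a, -u) : TimeSpace n) ∈ frechetNormalCone (graph S) p) :
    ENNReal.ofReal (max 0 a) ≤ orientedTalweg S p.fst :=
  le_iSup₂_of_le p.snd hp <| le_iSup₂_of_le u hu <| le_iSup₂_of_le a
    (frechetNormalCone_subset_limitingNormalCone _ _ ha) le_rfl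

theorem abs_le_talweg {S : ℝ → Set (Space n)} {p : TimeSpace n} (hp : p ∈ graph S)
    {u : Space n} (hu : ‖u‖ ≤ 1) {a : ℝ}
    (ha : (WithLp.toLp 2 (a, -u) : TimeSpace n) ∈ frechetNormalCone (graph S) p) :
    ENNReal.ofReal |a| ≤ talweg S p.fst :=
  le_iSup₂_of_le p.snd hp <| le_iSup₂_of_le u hu <| le_iSup₂_of_le a
    (frechetNormalCone_subset_limitingNormalCone _ _ ha) le_rfl

/-- The excess bound between the times `t` and `t + σ T`, `σ = ± 1`, for a one-sided bound `L` on
the Fréchet normals, allowed to be infinite. -/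
theorem excess_le_of_normals {S : ℝ → Set (Space n)} (hS : IsClosed (graph S)) {t σ T : ℝ}
    (hσ : σ * σ = 1) (hT : 0 ≤ T) {L : ℝ≥0∞}
    (hN : ∀ p ∈ graph S, 0 ≤ σ * (p.fst - t) → σ * (p.fst - t) ≤ T → ∀ (u : Space n) (a : ℝ),
      ‖u‖ ≤ 1 → (WithLp.toLp 2 (a, -u) : TimeSpace n) ∈ frechetNormalCone (graph S) p →
        ENNReal.ofReal (σ * a) ≤ L) :
    excess (S t) (S (t + σ * T)) ≤ L * ENNReal.ofReal T := by
  refine iSup₂_le fun x hx => ?_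
  rcases hT.eq_or_lt with rfl | hT0
  · simp [Metric.infEDist_zero_of_mem hx]
  rcases eq_or_ne L ⊤ with rfl | hL
  · rw [ENNReal.top_mul (by simpa using hT0)]
    exact le_top
  · refine (infEDist_le_of_normals hS hσ hT ENNReal.toReal_nonneg
      (fun p hp h0 h1 u a hu ha =>
        (ENNReal.ofReal_le_iff_le_toReal hL).1 (hN p hp h0 h1 u a hu ha)) hx).trans_eq ?_
    rw [ENNReal.ofReal_mul ENNReal.toReal_nonneg, ENNReal.ofReal_toReal hL]

end Sweeping

theorem lemma4p9 (n : ℕ) (S : ℝ → Set (Sweeping.Space n))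
    (hS : Sweeping.IsSmoothSweepingProcess S) (t₀ t₁ : ℝ) (h01 : t₀ ≤ t₁)
    (hdom : Set.Icc t₀ t₁ ⊆ Sweeping.dom S) :
    Sweeping.excess (S t₀) (S t₁) ≤
        (⨆ t ∈ Set.Icc t₀ t₁, Sweeping.orientedTalweg S t) * ENNReal.ofReal (t₁ - t₀) ∧
      Metric.hausdorffEDist (S t₀) (S t₁) ≤
        (⨆ t ∈ Set.Icc t₀ t₁, Sweeping.talweg S t) * ENNReal.ofReal (t₁ - t₀) := by
  have hC := hS.isClosed_graph
  have hT : 0 ≤ t₁ - t₀ := sub_nonneg.2 h01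
  have e1 : t₀ + 1 * (t₁ - t₀) = t₁ := by ring
  have e2 : t₁ + (-1) * (t₁ - t₀) = t₀ := by ring
  refine ⟨?_, ?_⟩
  · have h := Sweeping.excess_le_of_normals hC (t := t₀) (σ := 1) (by norm_num) hT
      (L := ⨆ t ∈ Set.Icc t₀ t₁, Sweeping.orientedTalweg S t) fun p hp h0 h1 u a hu ha => by
        refine le_iSup₂_of_le p.fst ⟨by linarith, by linarith⟩
          (le_trans ?_ (Sweeping.max_zero_le_orientedTalweg hp hu ha))
        exact ENNReal.ofReal_le_ofReal (by simp)
    rwa [e1] at h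
  · rw [Metric.hausdorffEDist_def]
    refine max_le ?_ ?_
    · have h := Sweeping.excess_le_of_normals hC (t := t₀) (σ := 1) (by norm_num) hT
        (L := ⨆ t ∈ Set.Icc t₀ t₁, Sweeping.talweg S t) fun p hp h0 h1 u a hu ha => by
          refine le_iSup₂_of_le p.fst ⟨by linarith, by linarith⟩
            (le_trans ?_ (Sweeping.abs_le_talweg hp hu ha))
          exact ENNReal.ofReal_le_ofReal (by simpa using le_abs_self a)
      rwa [e1] at h
    · have h := Sweeping.excess_le_of_normals hC (t := t₁) (σ := -1) (by norm_num) hT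
        (L := ⨆ t ∈ Set.Icc t₀ t₁, Sweeping.talweg S t) fun p hp h0 h1 u a hu ha => by
          refine le_iSup₂_of_le p.fst ⟨by linarith, by linarith⟩
            (le_trans ?_ (Sweeping.abs_le_talweg hp hu ha))
          exact ENNReal.ofReal_le_ofReal (by simpa using neg_le_abs a)
      rwa [e2] at h
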